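/- Let $\mathbb{M}^2$ be a normed plane (a two-dimensional real normed space), let $B(x,\lambda)$ and $S(x,\lambda)$ be the closed disc and the circle with center $x$ and radius $\lambda$, let $K=\{p_1,\dots,p_n\}$ be a finite non-empty set in $\mathbb{M}^2$, and let $\lambda>0$ with $\lambda\ge\lambda_K$, where $\lambda_K$ is the circumradius of $K$ (the smallest radius of a disc containing $K$). Put $$\operatorname{bh}(K,\lambda)=\bigcap_{K\subseteq B(x,\lambda)}B(x,\lambda),\qquad \operatorname{bi}(K,\lambda)=\bigcap_{p\in K}B(p,\lambda).$$ Boundary arcs and vertices are understood as follows. For distinct $p,q\in S(x,\lambda)$, a *minimal circular arc* of $B(x,\lambda)$ meeting $p$ and $q$ is the piece of $S(x,\lambda)$ with endpoints $p,q$ in the closed half-plane bounded by the line $pq$ whose interior does not contain $x$ (both half-circles, if $p$ and $q$ are opposite; the segment $\overline{pq}$, if it lies in $S(x,\lambda)$). * A *boundary arc of $\operatorname{bh}(K,\lambda)$ with center $x$* is a minimal circular arc of $B(x,\lambda)$ meeting two distinct points of $K$ and contained in the boundary of $\operatorname{bh}(K,\lambda)$, where $K\subseteq B(x,\lambda)$.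 The *vertices of $\operatorname{bh}(K,\lambda)$* are the endpoints of those boundary arcs that are not properly contained in another boundary arc with the same center; if $\operatorname{bh}(K,\lambda)$ is a single point, that point is its vertex. * A *boundary arc of $\operatorname{bi}(K,\lambda)$* is a connected component, with more than one point, of the intersection of the boundary of $\operatorname{bi}(K,\lambda)$ with a circle $S(p,\lambda)$, $p\in K$; if $\operatorname{bi}(K,\lambda)$ is a single point, that point is also a (degenerate) boundary arc. The *vertices of $\operatorname{bi}(K,\lambda)$* are the endpoints of its boundary arcs (a full circle has no endpoints; the point of a degenerate arc is its endpoint). A point $v$ is *a center* of such an arc $A$ if $A\subseteq S(v,\lambda)$. Theorem. If $\mathbb{M}^2$ is strictly convex or $\lambda\ge\operatorname{diam}(K)$, then every boundary arc of $\operatorname{bi}(K,\lambda)$ has a vertex of $\operatorname{bh}(K,\lambda)$ as a center. Moreover, every vertex of $\operatorname{bi}(K,\lambda)$ is the center of a boundary arc of $\operatorname{bh}(K,\lambda)$. -/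

import Mathlib

namespace NormedPlane

variable {E : Type*} [NormedAddCommGroup E] [NormedSpace ℝ E]

/-- The ball hull `bh(K, r)`: the intersection of all closed balls of radius `r` containing `K`. -/
def ballHull (K : Set E) (r : ℝ) : Set E :=
  ⋂ (x : E) (_ : K ⊆ Metric.closedBall x r), Metric.closedBall x r

/-- The ball intersection `bi(K, r)`: the intersection of all closed balls of radius `r` with
center in `K`. -/
def ballIntersection (K : Set E) (r : ℝ) : Set E :=
  ⋂ x ∈ K, Metric.closedBall x r

/-- The circumradius of `K`: the least radius of a closed ball containing `K`. -/
noncomputable def circumradius (K : Set E) : ℝ :=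
  sInf {r : ℝ | ∃ x : E, K ⊆ Metric.closedBall x r}

/-- `A` is a minimal circular arc of the disc `B(x, r)` meeting the two distinct points `p` and `q`
of the circle `S(x, r)`: the piece of the circle with endpoints `p` and `q` in a closed half-plane
`{f p ≤ f y}` that is bounded by the line `pq` and does not have the center `x` in its interior.
On the line `pq` itself only points of the segment `pq` are admitted (this matters only if the
segment `pq` lies in the circle; then the arc is that segment). If `p` and `q` are opposite in the
circle, then `f` and `-f` give two minimal arcs, the two half-circles. -/
def IsMinimalArc (x : E) (r : ℝ) (p q : E) (A : Set E) : Prop :=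
  p ≠ q ∧ p ∈ Metric.sphere x r ∧ q ∈ Metric.sphere x r ∧
    ∃ f : E →ₗ[ℝ] ℝ, f ≠ 0 ∧ f p = f q ∧ f x ≤ f p ∧
      A = {y | y ∈ Metric.sphere x r ∧ (f p < f y ∨ y ∈ segment ℝ p q)}

/-- `A` is an arc, with center `x` and endpoints `p, q ∈ K`, of the boundary of the ball hull of
`K`: a minimal circular arc meeting `p` and `q`, of a disc `B(x, r)` that contains `K`, lying in
the boundary of the ball hull. -/
def IsHullArc (K : Set E) (r : ℝ) (x p q : E) (A : Set E) : Prop :=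
  K ⊆ Metric.closedBall x r ∧ p ∈ K ∧ q ∈ K ∧ IsMinimalArc x r p q A ∧
    A ⊆ frontier (ballHull K r)

/-- The vertices of the ball hull: the endpoints of its boundary arcs, where on every circle only
the inclusion-maximal arcs count. If the ball hull is a single point, its boundary is a degenerate
arc and that point is its vertex. -/
def IsHullVertex (K : Set E) (r : ℝ) (p : E) : Prop :=
  (∃ (x q : E) (A : Set E), IsHullArc K r x p q A ∧
    ∀ (p' q' : E) (A' : Set E), IsHullArc K r x p' q' A' → A ⊆ A' → A' = A) ∨
  ballHull K r = {p}

/-- `A` is a (maximal) arc, with center `p ∈ K`, of the boundary of the ball intersection of `K`: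
a connected component of the part of this boundary on the circle `S(p, r)`. An arc has more than
one point, except that a one-point ball intersection is a degenerate arc. -/
def IsIntersectionArc (K : Set E) (r : ℝ) (p : E) (A : Set E) : Prop :=
  p ∈ K ∧
  (∃ y ∈ Metric.sphere p r ∩ frontier (ballIntersection K r),
    A = connectedComponentIn (Metric.sphere p r ∩ frontier (ballIntersection K r)) y) ∧
  (A.Nontrivial ∨ (ballIntersection K r).Subsingleton)

/-- The vertices of the ball intersection: the endpoints of its boundary arcs. The endpoints of an
arc `A` of a circle are the points of `A` that are limits of points of the circle outside `A`
(a full circle has none). -/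
def IsIntersectionVertex (K : Set E) (r : ℝ) (x : E) : Prop :=
  ∃ (p : E) (A : Set E), IsIntersectionArc K r p A ∧
    x ∈ A ∧ x ∈ closure (Metric.sphere p r \ A)

end NormedPlane

namespace NormedPlane
open Metric Filter Topology

variable {E : Type*} [NormedAddCommGroup E] [NormedSpace ℝ E]

/-! Points of `bi` are exactly the centers of the discs containing `K`. If `x` is an endpoint of an
arc `A` of `bi` with center `p`, then `S(x, r)` carries a second point of `K` besides `p`
(`exists_ne_mem_sphere`). A disc of radius `r` containing two points of `K` contains each minimal
arc between them (`IsMinimalArc.subset_closedBall`), so the minimal arcs of `B(x, r)` between these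
two points are hull arcs with center `x`. This settles the vertices of `bi`.

For the arc `A`, enlarge such a hull arc to a maximal one; its endpoints `q₁, q₂` are hull vertices
and it contains `p`. Suppose that `A` lies on neither `S(q₁, r)` nor `S(q₂, r)`, as witnessed by
`y₁` and `y₂`. Equality in the triangle inequality puts the segments from `x` to `y₁` and `y₂` on
`S(p, r)`, and near `x` they exhaust that circle. Then `x` is no endpoint of `A`, a contradiction
(`subset_sphere_or_subset_sphere`). If `A` is a full circle, then `K = {p}`. -/

/-! ### Norm inequalities for a circle around the origin. -/

theorem coeff_le_of_norm_le {p q z : E} {r c d e : ℝ} (hr : 0 < r) (hq : ‖q‖ = r)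
    (hp : ‖p‖ ≤ r) (hz : ‖z‖ ≤ r) (hc : 0 ≤ c) (hd : 0 ≤ d)
    (h : e • q = c • p + d • z) : e ≤ c + d := by
  have h1 : ‖e • q‖ ≤ c * r + d * r := by
    rw [h]
    refine (norm_add_le _ _).trans ?_
    rw [norm_smul, norm_smul, Real.norm_of_nonneg hc, Real.norm_of_nonneg hd]
    gcongr
  rw [norm_smul, hq, ← add_mul] at h1
  exact (le_abs_self e).trans (le_of_mul_le_mul_right h1 hr)

theorem eq_of_norm_smul_add_smul {p q : E} [StrictConvexSpace ℝ E] {r c d : ℝ}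
    (hc : 0 < c) (hd : 0 < d) (hp : ‖p‖ ≤ r) (hq : ‖q‖ ≤ r)
    (h : ‖c • p + d • q‖ = (c + d) * r) : p = q := by
  by_contra hne
  have h1 := combo_mem_ball_of_ne (x := p) (y := q) (z := (0 : E)) (r := r) (a := c / (c + d))
    (b := d / (c + d)) (by simpa using hp) (by simpa using hq) hne (by positivity) (by positivity)
    (by field_simp)
  rw [mem_ball_zero_iff] at h1
  have h2 : (c + d) • ((c / (c + d)) • p + (d / (c + d)) • q) = c • p + d • q := by
    rw [smul_add, smul_smul, smul_smul]
    congr 2 <;> field_simp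
  rw [← h2, norm_smul, Real.norm_of_nonneg (by positivity)] at h
  have := mul_left_cancel₀ (by positivity) h
  linarith

/-- If both coordinates were negative, two triangle inequalities would force `a = b`. Strict
convexity excludes this equality case, and `‖p - q‖ ≤ r` excludes it by a third inequality. -/
theorem not_both_neg {p q : E} {r a b : ℝ} (hr : 0 < r)
    (H : StrictConvexSpace ℝ E ∨ ‖p - q‖ ≤ r) (hli : LinearIndependent ℝ ![p, q])
    (hp : ‖p‖ = r) (hq : ‖q‖ = r)
    (h1 : ‖p - (a • p + b • q)‖ ≤ r) (h2 : ‖q - (a • p + b • q)‖ ≤ r) (ha : a < 0) :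
    0 ≤ b := by
  by_contra! hb
  have e1 := coeff_le_of_norm_le hr hp h1 (z := -q) (by simp [hq]) zero_le_one
    (d := -b) (by linarith) (e := 1 - a) (by module)
  have e2 := coeff_le_of_norm_le hr hq h2 (z := -p) (by simp [hp]) zero_le_one
    (d := -a) (by linarith) (e := 1 - b) (by module)
  obtain rfl : a = b := by linarith
  rcases H with H | H
  · have h3 : p - (a • p + a • q) = -q := by
      refine eq_of_norm_smul_add_smul (c := 1) (d := -a) one_pos (by linarith) h1
        (by simp [hq]) ?_
      have : (1 : ℝ) • (p - (a • p + a • q)) + (-a) • (-q) = (1 - a) • p := by module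
      rw [this, norm_smul, hp, Real.norm_of_nonneg (by linarith)]
      ring
    have := LinearIndependent.pair_iff.1 hli (1 - a) (1 - a) (by
      rw [← sub_eq_zero] at h3
      rw [← h3]
      module)
    linarith [this.1]
  · have e3 := coeff_le_of_norm_le hr hp h1 H zero_le_one
      (d := -a) (by linarith) (e := 1 - 2 * a) (by module)
    linarith

/-- The ray from `z` in direction `-y` meets the segment between `p` and `q`, if `z` is on the
minimal arc between `p` and `q` of the circle around `0`, and `p` and `q` are in the disc
around `y`. -/
theorem exists_sub_smul_mem_segment {p q z y : E} {r α β a b : ℝ} (hr : 0 < r)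
    (H : StrictConvexSpace ℝ E ∨ ‖p - q‖ ≤ r) (hli : LinearIndependent ℝ ![p, q])
    (hp : ‖p‖ = r) (hq : ‖q‖ = r) (hz : ‖z‖ = r) (hα : 0 ≤ α) (hβ : 0 ≤ β) (hαβ : 1 ≤ α + β)
    (hzα : z = α • p + β • q) (hy : y = a • p + b • q) (hy0 : y ≠ 0)
    (h1 : ‖p - y‖ ≤ r) (h2 : ‖q - y‖ ≤ r) :
    ∃ γ : ℝ, 0 ≤ γ ∧ z - γ • y ∈ segment ℝ p q := by
  suffices ∃ γ : ℝ, 0 ≤ γ ∧ 0 ≤ α - γ * a ∧ 0 ≤ β - γ * b ∧ α - γ * a + (β - γ * b) = 1 by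
    obtain ⟨γ, h0, hμ, hν, hs⟩ := this
    exact ⟨γ, h0, _, _, hμ, hν, hs, by rw [hzα, hy]; module⟩
  -- `hA` and `hB` say that the two coordinates of `z - γ • y` are nonnegative for `γ = (α + β - 1)
  -- / (a + b)`, the value making their sum `1`.
  have hA : 0 ≤ a → a * (β - 1) ≤ α * b := fun ha ↦ by
    have := coeff_le_of_norm_le hr hq h2 hz.le hα ha (e := α * (1 - b) + a * β)
      (by rw [hzα, hy]; module)
    linarith
  have hB : 0 ≤ b → b * (α - 1) ≤ β * a := fun hb ↦ by
    have := coeff_le_of_norm_le hr hp h1 hz.le hβ hb (e := β * (1 - a) + b * α)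
      (by rw [hzα, hy]; module)
    linarith
  have hα1 : β = 0 → α = 1 := fun h ↦ by
    rw [hzα, h, zero_smul, add_zero, norm_smul, hp, Real.norm_of_nonneg hα] at hz
    exact mul_right_cancel₀ hr.ne' (by linarith)
  have hβ1 : α = 0 → β = 1 := fun h ↦ by
    rw [hzα, h, zero_smul, zero_add, norm_smul, hq, Real.norm_of_nonneg hβ] at hz
    exact mul_right_cancel₀ hr.ne' (by linarith)
  have hab : a < 0 → 0 ≤ b := fun ha ↦
    not_both_neg hr H hli hp hq (hy ▸ h1) (hy ▸ h2) ha
  by_cases hs : α + β = 1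
  · exact ⟨0, le_rfl, by simpa, by simpa, by linarith⟩
  have hαβ' : 1 < α + β := lt_of_le_of_ne hαβ (Ne.symm hs)
  have hα0 : 0 < α := hα.lt_of_ne fun h ↦ hs (by rw [← h, hβ1 h.symm, zero_add])
  have hβ0 : 0 < β := hβ.lt_of_ne fun h ↦ hs (by rw [← h, hα1 h.symm, add_zero])
  have hpos : 0 < a + b := by
    by_contra! hle
    rcases lt_trichotomy a 0 with ha | rfl | ha
    · have := hB (hab ha)
      have h3 : b * (α + β - 1) ≤ 0 := by nlinarith
      have h4 : b ≤ 0 := nonpos_of_mul_nonpos_left h3 (by linarith)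
      nlinarith [le_antisymm h4 (hab ha)]
    · rcases eq_or_lt_of_le (show b ≤ 0 by linarith) with rfl | hb
      · simp [hy] at hy0
      · nlinarith [hA le_rfl]
    · have := hA ha.le
      nlinarith
  have hA' : a * (β - 1) ≤ α * b := by
    by_cases ha : 0 ≤ a
    · exact hA ha
    · nlinarith
  have hB' : b * (α - 1) ≤ β * a := by
    by_cases hb : 0 ≤ b
    · exact hB hb
    · nlinarith
  refine ⟨(α + β - 1) / (a + b), by apply div_nonneg <;> linarith, ?_, ?_, ?_⟩
  · rw [sub_nonneg, div_mul_eq_mul_div, div_le_iff₀ hpos]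
    linarith
  · rw [sub_nonneg, div_mul_eq_mul_div, div_le_iff₀ hpos]
    linarith
  · field_simp
    ring

/-- `(1 + γ) • (z - y)` is `γ • z` plus a convex combination of `p - y` and `q - y`. -/
theorem norm_sub_le_of_sub_smul_mem_segment {p q z y : E} {r γ : ℝ}
    (hz : ‖z‖ = r) (h1 : ‖p - y‖ ≤ r) (h2 : ‖q - y‖ ≤ r)
    (hγ : 0 ≤ γ) (h : z - γ • y ∈ segment ℝ p q) : ‖z - y‖ ≤ r := by
  obtain ⟨μ, ν, hμ, hν, hs, h⟩ := h
  have e : (1 + γ) • (z - y) = γ • z + (μ • (p - y) + ν • (q - y)) := by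
    have : μ • (p - y) + ν • (q - y) = z - γ • y - (μ + ν) • y := by rw [← h]; module
    rw [this, hs]; module
  have e2 : ‖(1 + γ) • (z - y)‖ ≤ γ * r + (μ * r + ν * r) := by
    rw [e]
    refine (norm_add_le _ _).trans (add_le_add ?_ ((norm_add_le _ _).trans (add_le_add ?_ ?_)))
    · rw [norm_smul, Real.norm_of_nonneg hγ, hz]
    · rw [norm_smul, Real.norm_of_nonneg hμ]; gcongr
    · rw [norm_smul, Real.norm_of_nonneg hν]; gcongr
  rw [norm_smul, Real.norm_of_nonneg (by linarith), ← add_mul, hs, one_mul] at e2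
  nlinarith

/-- Equality case of the previous estimate: as `‖p - y‖ < r`, the weight of `p` must vanish. -/
theorem eq_of_sub_smul_mem_segment {p q z y : E} {r γ : ℝ}
    (hz : ‖z‖ = r) (hzy : ‖z - y‖ = r) (h1 : ‖p - y‖ < r) (h2 : ‖q - y‖ ≤ r)
    (hγ : 0 ≤ γ) (h : z - γ • y ∈ segment ℝ p q) : z - γ • y = q ∧ ‖q - y‖ = r := by
  obtain ⟨μ, ν, hμ, hν, hs, h⟩ := h
  have e : (1 + γ) • (z - y) = γ • z + (μ • (p - y) + ν • (q - y)) := by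
    have : μ • (p - y) + ν • (q - y) = z - γ • y - (μ + ν) • y := by rw [← h]; module
    rw [this, hs]; module
  have e2 : ‖(1 + γ) • (z - y)‖ ≤ γ * r + (μ * ‖p - y‖ + ν * ‖q - y‖) := by
    rw [e]
    refine (norm_add_le _ _).trans (add_le_add ?_ ((norm_add_le _ _).trans (add_le_add ?_ ?_)))
    · rw [norm_smul, Real.norm_of_nonneg hγ, hz]
    · rw [norm_smul, Real.norm_of_nonneg hμ]
    · rw [norm_smul, Real.norm_of_nonneg hν]
  rw [norm_smul, Real.norm_of_nonneg (by linarith), hzy] at e2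
  obtain rfl : ν = 1 - μ := by linarith
  obtain rfl : μ = 0 := by
    by_contra hne
    have : 0 < μ := hμ.lt_of_ne (Ne.symm hne)
    nlinarith
  refine ⟨by rw [← h]; module, le_antisymm h2 (by linarith)⟩

/-! ### Coordinates and functionals in the plane. -/

theorem exists_eq_smul_add_smul (hE : Module.finrank ℝ E = 2) {p q : E}
    (hli : LinearIndependent ℝ ![p, q]) (y : E) : ∃ a b : ℝ, y = a • p + b • q := by
  have : FiniteDimensional ℝ E := .of_finrank_pos (by omega)
  have h := hli.span_eq_top_of_card_eq_finrank' (by simp [hE])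
  have hy : y ∈ Submodule.span ℝ (Set.range ![p, q]) := h ▸ Submodule.mem_top
  rw [Matrix.range_cons_cons_empty, Submodule.mem_span_pair] at hy
  obtain ⟨a, b, h⟩ := hy
  exact ⟨a, b, h.symm⟩

theorem exists_ne_zero_eq (hE : Module.finrank ℝ E = 2) (v : E) :
    ∃ f : E →ₗ[ℝ] ℝ, f ≠ 0 ∧ f v = 0 := by
  have : FiniteDimensional ℝ E := .of_finrank_pos (by omega)
  have hlt : Submodule.span ℝ {v} < ⊤ := by
    rw [lt_top_iff_ne_top]
    intro h
    have := finrank_span_le_card (R := ℝ) ({v} : Set E)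
    rw [h, finrank_top, hE] at this
    simp at this
  obtain ⟨f, hf, hle⟩ := Submodule.exists_le_ker_of_lt_top _ hlt
  exact ⟨f, hf, hle (Submodule.mem_span_singleton_self v)⟩

theorem linearIndependent_of_norm_eq {p q : E} {r : ℝ} (hr : 0 < r) (hp : ‖p‖ = r)
    (hq : ‖q‖ = r) (hne : p ≠ q) (hne' : p ≠ -q) : LinearIndependent ℝ ![p, q] := by
  have hp0 : p ≠ 0 := by rintro rfl; simp at hp; linarith
  rw [LinearIndependent.pair_iff' hp0]
  rintro c rfl
  rw [norm_smul, hp, Real.norm_eq_abs] at hq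
  have : |c| = 1 := mul_right_cancel₀ hr.ne' (by linarith)
  rcases eq_or_eq_neg_of_abs_eq this with rfl | rfl
  · simp at hne
  · simp at hne'

/-- Points of the minimal arc between `p` and `q` lie in the cone spanned by `p` and `q`. -/
theorem exists_coords_of_lt {p q z : E} {r : ℝ} (hE : Module.finrank ℝ E = 2) (hr : 0 < r)
    (hli : LinearIndependent ℝ ![p, q]) (hp : ‖p‖ = r) (hq : ‖q‖ = r) (hz : ‖z‖ = r)
    {f : E →ₗ[ℝ] ℝ} (hf : f ≠ 0) (hpq : f p = f q) (h0 : 0 ≤ f p)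
    (hfz : f p < f z ∨ z ∈ segment ℝ p q) :
    ∃ α β : ℝ, 0 ≤ α ∧ 0 ≤ β ∧ 1 ≤ α + β ∧ z = α • p + β • q := by
  rcases hfz with hfz | ⟨α, β, hα, hβ, hs, rfl⟩
  swap
  · exact ⟨α, β, hα, hβ, hs.ge, rfl⟩
  obtain ⟨α, β, rfl⟩ := exists_eq_smul_add_smul hE hli z
  have hp0 : 0 < f p := h0.lt_of_ne fun h ↦ hf <| by
    ext w
    obtain ⟨a, b, rfl⟩ := exists_eq_smul_add_smul hE hli w
    simp [← hpq, ← h]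
  have hs : 1 < α + β := by
    simp only [map_add, map_smul, smul_eq_mul, ← hpq] at hfz
    nlinarith
  refine ⟨α, β, ?_, ?_, hs.le, rfl⟩
  -- If `α < 0`, then `β • q = z + (-α) • p` gives `β ≤ 1 - α`, against `1 < α + β`.
  · by_contra! hneg
    have := coeff_le_of_norm_le hr hq hz.le hp.le zero_le_one (d := -α) (by linarith) (e := β)
      (by module)
    linarith
  · by_contra! hneg
    have := coeff_le_of_norm_le hr hp hz.le hq.le zero_le_one (d := -β) (by linarith) (e := α)
      (by module)
    linarith

/-! ### Opposite points, and segments in a circle. -/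

/-- Opposite points have distance `2 * r`, which is impossible under the diameter bound; under
strict convexity the midpoint is the only possible center. -/
theorem eq_zero_of_norm_sub_neg {q y : E} {r : ℝ} (hr : 0 < r)
    (H : StrictConvexSpace ℝ E ∨ ‖-q - q‖ ≤ r) (hq : ‖q‖ = r)
    (h1 : ‖-q - y‖ ≤ r) (h2 : ‖q - y‖ ≤ r) : y = 0 := by
  have h3 : ‖-q - q‖ = 2 * r := by
    rw [show -q - q = (-2 : ℝ) • q by module, norm_smul, hq]; norm_num
  rcases H with H | H
  · have : -(-q - y) = q - y := eq_of_norm_smul_add_smul (c := 1) (d := 1) one_pos one_pos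
      (by rwa [norm_neg]) h2 (by
        rw [show (1 : ℝ) • -(-q - y) + (1 : ℝ) • (q - y) = -(-q - q) by module, norm_neg, h3]
        ring)
    have h4 : (2 : ℝ) • y = 0 := by
      rw [← sub_eq_zero] at this
      rw [← this]; module
    simpa using h4
  · linarith

/-- The convex function `t ↦ ‖z - t • y‖` takes the value `r` at `0`, `1` and `1 + γ`, hence is
constant in between. -/
theorem norm_sub_smul_eq {z y : E} {r γ s : ℝ} (hγ : 0 < γ) (h0 : ‖z‖ = r) (h1 : ‖z - y‖ = r)
    (h2 : ‖z - (1 + γ) • y‖ = r) (hs0 : 0 ≤ s) (hs1 : s ≤ 1) : ‖z - s • y‖ = r := by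
  apply le_antisymm
  · rw [show z - s • y = (1 - s) • z + s • (z - y) by module]
    refine (norm_add_le _ _).trans ?_
    rw [norm_smul, norm_smul, Real.norm_of_nonneg hs0, Real.norm_of_nonneg (by linarith), h0, h1]
    linarith
  · have h3 : ‖(1 + γ - s) • (z - y)‖ ≤ γ * ‖z - s • y‖ + (1 - s) * r := by
      rw [show (1 + γ - s) • (z - y) = γ • (z - s • y) + (1 - s) • (z - (1 + γ) • y) by module]
      refine (norm_add_le _ _).trans ?_
      rw [norm_smul, norm_smul, Real.norm_of_nonneg hγ.le, Real.norm_of_nonneg (by linarith), h2]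
    rw [norm_smul, Real.norm_of_nonneg (by linarith), h1] at h3
    nlinarith

/-- Write `u = c • z + t • y` with `t ≥ 0`. By `hsmall`, `z - u` is a nonnegative combination of `z`
and `z - y`. The norm is additive there because the segment between them lies in the circle, so `‖z
- u‖ = (1 - c) * r` and `c = 0`. -/
theorem mem_segment_of_norm_sub_eq {p q z y u : E} {r α β γ a b : ℝ} (hr : 0 < r) (hα : 0 < α)
    (hγ : 0 ≤ γ) (hz : z = α • p + β • q) (hzq : z - q = γ • y)
    (hseg : ∀ s : ℝ, 0 ≤ s → s ≤ 1 → ‖z - s • y‖ = r) (hu : u = a • p + b • q)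
    (hab : α * b ≤ β * a) (hsmall : a / α + (γ - 1) * ((β * a - α * b) / α) ≤ 1)
    (hn : ‖z - u‖ = r) : u ∈ segment ℝ 0 y := by
  -- In the basis `z, q` the coordinates of `u` are `a / α` and `-d`.
  set d := (β * a - α * b) / α with hd
  have hd0 : 0 ≤ d := div_nonneg (by linarith) hα.le
  have hu' : u = (a / α - d) • z + (d * γ) • y := by
    have h1 : (d * γ) • y = d • (z - q) := by rw [hzq, smul_smul]
    rw [h1, hu, hz, hd]
    match_scalars <;> field_simp <;> ring
  have hs0 : 0 ≤ d * γ := mul_nonneg hd0 hγ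
  have hw : 0 ≤ 1 - (a / α - d) - d * γ := by linarith
  have key : d * γ + (1 - (a / α - d) - d * γ) = 1 := by
    have hpos : 0 < d * γ + (1 - (a / α - d) - d * γ) := by
      refine lt_of_le_of_ne (by positivity) fun h0 ↦ ?_
      have h1 : d * γ = 0 := by linarith
      have h2 : a / α - d = 1 := by linarith
      rw [hu', h1, h2] at hn
      simp at hn
      exact hr.ne hn
    have e : z - u = (d * γ + (1 - (a / α - d) - d * γ)) •
        (z - (d * γ / (d * γ + (1 - (a / α - d) - d * γ))) • y) := by
      rw [smul_sub, smul_smul, mul_div_cancel₀ _ hpos.ne', hu']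
      module
    rw [e, norm_smul, hseg _ (by positivity) ((div_le_one hpos).2 (by linarith)),
      Real.norm_of_nonneg hpos.le] at hn
    exact mul_right_cancel₀ hr.ne' (by linarith)
  have hc : a / α - d = 0 := by linarith
  rw [hc, zero_smul, zero_add] at hu'
  exact ⟨1 - d * γ, d * γ, by linarith, hs0, by ring, by rw [hu']; module⟩

/-- If a circle contains the segments `z - [0, y₁]` and `z - [0, y₂]` on either side of its
point `z`, then it coincides with their union near `z`. -/
theorem eventually_mem_segment {p q z y₁ y₂ : E} {r α β γ₁ γ₂ : ℝ}
    (hE : Module.finrank ℝ E = 2) (hli : LinearIndependent ℝ ![p, q])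
    (hr : 0 < r) (hα : 0 < α) (hβ : 0 < β)
    (hγ₁ : 0 ≤ γ₁) (hγ₂ : 0 ≤ γ₂) (hz : z = α • p + β • q)
    (h₁ : z - q = γ₁ • y₁) (h₂ : z - p = γ₂ • y₂)
    (hs₁ : ∀ s : ℝ, 0 ≤ s → s ≤ 1 → ‖z - s • y₁‖ = r)
    (hs₂ : ∀ s : ℝ, 0 ≤ s → s ≤ 1 → ‖z - s • y₂‖ = r) :
    ∀ᶠ u in 𝓝 (0 : E), ‖z - u‖ = r → u ∈ segment ℝ 0 y₁ ∪ segment ℝ 0 y₂ := by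
  have : FiniteDimensional ℝ E := .of_finrank_pos (by omega)
  let B := basisOfLinearIndependentOfCardEqFinrank hli (by simp [hE])
  have hB : ∀ u, u = B.coord 0 u • p + B.coord 1 u • q := fun u ↦ by
    conv_lhs => rw [← B.sum_repr u]
    simp [B, Fin.sum_univ_two]
  have hc0 : Continuous (B.coord 0) := LinearMap.continuous_of_finiteDimensional _
  have hc1 : Continuous (B.coord 1) := LinearMap.continuous_of_finiteDimensional _
  -- `e1` and `e2` provide `hsmall` on the two sides of the line through `z`: both expressions
  -- vanish at `u = 0`.
  have e1 : ∀ᶠ u in 𝓝 (0 : E), B.coord 0 u / α +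
      (γ₁ - 1) * ((β * B.coord 0 u - α * B.coord 1 u) / α) < 1 := by
    exact (isOpen_lt (by fun_prop) continuous_const).mem_nhds (by simp)
  have e2 : ∀ᶠ u in 𝓝 (0 : E), B.coord 1 u / β +
      (γ₂ - 1) * ((α * B.coord 1 u - β * B.coord 0 u) / β) < 1 := by
    exact (isOpen_lt (by fun_prop) continuous_const).mem_nhds (by simp)
  filter_upwards [e1, e2] with u h1 h2 hn
  rcases le_total (α * B.coord 1 u) (β * B.coord 0 u) with h | h
  · exact .inl (mem_segment_of_norm_sub_eq hr hα hγ₁ hz h₁ hs₁ (hB u) h h1.le hn)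
  · exact .inr (mem_segment_of_norm_sub_eq hr hβ hγ₂ (by rw [hz, add_comm]) h₂ hs₂
      (by rw [add_comm]; exact hB u) h h2.le hn)

/-! ### Ball hulls, ball intersections and minimal arcs. -/

theorem mem_frontier_of_mem_sphere {C : Set E} {c z : E} {r : ℝ} (hr : 0 < r)
    (hC : C ⊆ closedBall c r) (hz : z ∈ C) (hzs : z ∈ sphere c r) : z ∈ frontier C := by
  refine ⟨subset_closure hz, fun hi ↦ ?_⟩
  have := interior_mono hC hi
  rw [interior_closedBall _ hr.ne', mem_ball] at this
  exact this.ne hzs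

theorem mem_ballIntersection {E : Type*} [NormedAddCommGroup E] {K : Set E} {r : ℝ} {y : E} :
    y ∈ ballIntersection K r ↔ K ⊆ closedBall y r := by
  simp [ballIntersection, Set.subset_def, dist_comm]

theorem isClosed_ballIntersection {E : Type*} [NormedAddCommGroup E] (K : Set E) (r : ℝ) :
    IsClosed (ballIntersection K r) :=
  isClosed_biInter fun _ _ ↦ isClosed_closedBall

theorem convex_ballIntersection (K : Set E) (r : ℝ) : Convex ℝ (ballIntersection K r) :=
  convex_iInter₂ fun _ _ ↦ convex_closedBall _ _

theorem subset_ballHull {E : Type*} [NormedAddCommGroup E] (K : Set E) (r : ℝ) :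
    K ⊆ ballHull K r :=
  Set.subset_iInter₂ fun _ h ↦ h

theorem ballHull_singleton [Nontrivial E] {r : ℝ} (hr : 0 < r) (p : E) : ballHull {p} r = {p} := by
  refine (subset_ballHull _ _).antisymm' fun y hy ↦ ?_
  by_contra hne
  rw [Set.mem_singleton_iff, ← sub_eq_zero, ← norm_eq_zero] at hne
  have hpos : 0 < ‖y - p‖ := (norm_nonneg _).lt_of_ne' hne
  -- This center lies at distance `r` from `p`, on the side away from `y`, so its distance from `y`
  -- exceeds `r`.
  have h1 := Set.mem_iInter₂.1 hy (p - (r / ‖y - p‖) • (y - p)) (by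
    simp [norm_smul, abs_of_pos hr, hne])
  rw [mem_closedBall, dist_eq_norm, show y - (p - (r / ‖y - p‖) • (y - p)) =
    (1 + r / ‖y - p‖) • (y - p) by module, norm_smul, Real.norm_of_nonneg (by positivity),
    add_mul, div_mul_cancel₀ _ hne] at h1
  linarith

theorem IsMinimalArc.symm {x p q : E} {r : ℝ} {A : Set E} (h : IsMinimalArc x r p q A) :
    IsMinimalArc x r q p A := by
  obtain ⟨hne, hp, hq, f, hf, hpq, hx, rfl⟩ := h
  exact ⟨hne.symm, hq, hp, f, hf, hpq.symm, hpq ▸ hx, by rw [segment_symm, hpq]⟩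

theorem IsMinimalArc.left_mem {x p q : E} {r : ℝ} {A : Set E} (h : IsMinimalArc x r p q A) :
    p ∈ A := by
  obtain ⟨hne, hp, hq, f, hf, hpq, hx, rfl⟩ := h
  exact ⟨hp, .inr (left_mem_segment ℝ p q)⟩

theorem IsMinimalArc.subset_sphere {x p q : E} {r : ℝ} {A : Set E} (h : IsMinimalArc x r p q A) :
    A ⊆ sphere x r := by
  obtain ⟨hne, hp, hq, f, hf, hpq, hx, rfl⟩ := h
  exact fun _ h ↦ h.1

theorem IsHullArc.symm {K : Set E} {x p q : E} {r : ℝ} {A : Set E} (h : IsHullArc K r x p q A) :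
    IsHullArc K r x q p A :=
  ⟨h.1, h.2.2.1, h.2.1, h.2.2.2.1.symm, h.2.2.2.2⟩

theorem exists_isMinimalArc (hE : Module.finrank ℝ E = 2) {x p q : E} {r : ℝ} (hne : p ≠ q)
    (hp : p ∈ sphere x r) (hq : q ∈ sphere x r) : ∃ A, IsMinimalArc x r p q A := by
  obtain ⟨f, hf, h⟩ := exists_ne_zero_eq hE (p - q)
  rw [map_sub, sub_eq_zero] at h
  rcases le_total (f x) (f p) with hx | hx
  · exact ⟨_, hne, hp, hq, f, hf, h, hx, rfl⟩
  · exact ⟨_, hne, hp, hq, -f, by simpa, by simpa, by simpa, rfl⟩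

theorem IsMinimalArc.exists_coords (hE : Module.finrank ℝ E = 2) {x p q z : E} {r : ℝ}
    (hr : 0 < r) {A : Set E} (h : IsMinimalArc x r p q A)
    (hli : LinearIndependent ℝ ![p - x, q - x]) (hz : z ∈ A) :
    ∃ α β : ℝ, 0 ≤ α ∧ 0 ≤ β ∧ 1 ≤ α + β ∧ z - x = α • (p - x) + β • (q - x) := by
  obtain ⟨hne, hp, hq, f, hf, hpq, hx, rfl⟩ := h
  rw [mem_sphere_iff_norm] at hp hq
  have hzs := mem_sphere_iff_norm.1 hz.1
  refine exists_coords_of_lt hE hr hli hp hq hzs hf (by simp [hpq]) (by simpa using hx) ?_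
  rcases hz.2 with h | ⟨a, b, ha, hb, hs, h⟩
  · left; simpa using h
  · refine .inr ⟨a, b, ha, hb, hs, ?_⟩
    rw [← h, show a • (p - x) + b • (q - x) = a • p + b • q - (a + b) • x by module, hs, one_smul]

/-- Move `x` to the origin. If `p` and `q` are opposite, then `y = x`; otherwise the ray from `z` in
direction `x - y` meets the segment `pq`, and convexity bounds `‖z - y‖`. -/
theorem IsMinimalArc.subset_closedBall (hE : Module.finrank ℝ E = 2) {x y p q : E} {r : ℝ}
    (hr : 0 < r) (H : StrictConvexSpace ℝ E ∨ dist p q ≤ r) {A : Set E}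
    (h : IsMinimalArc x r p q A) (hpy : dist p y ≤ r) (hqy : dist q y ≤ r) :
    A ⊆ closedBall y r := by
  intro z hz
  have hzs := h.subset_sphere hz
  have hp := mem_sphere_iff_norm.1 h.2.1
  have hq := mem_sphere_iff_norm.1 h.2.2.1
  have hzx := mem_sphere_iff_norm.1 hzs
  have H' : StrictConvexSpace ℝ E ∨ ‖(p - x) - (q - x)‖ ≤ r := by
    rwa [sub_sub_sub_cancel_right, ← dist_eq_norm]
  have hpy' : ‖(p - x) - (y - x)‖ ≤ r := by rwa [sub_sub_sub_cancel_right, ← dist_eq_norm]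
  have hqy' : ‖(q - x) - (y - x)‖ ≤ r := by rwa [sub_sub_sub_cancel_right, ← dist_eq_norm]
  by_cases hy0 : y - x = 0
  · rw [sub_eq_zero.1 hy0]; exact sphere_subset_closedBall hzs
  by_cases hop : p - x = -(q - x)
  · rw [hop] at H' hpy'
    exact absurd (eq_zero_of_norm_sub_neg hr H' hq hpy' hqy') hy0
  have hli := linearIndependent_of_norm_eq hr hp hq (by simpa using h.1) hop
  obtain ⟨α, β, hα, hβ, hs, e⟩ := h.exists_coords hE hr hli hz
  obtain ⟨a, b, hab⟩ := exists_eq_smul_add_smul hE hli (y - x)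
  obtain ⟨γ, hγ, hm⟩ := exists_sub_smul_mem_segment hr H' hli hp hq hzx hα hβ hs e hab hy0
    hpy' hqy'
  have := norm_sub_le_of_sub_smul_mem_segment hzx hpy' hqy' hγ hm
  rwa [sub_sub_sub_cancel_right, ← dist_eq_norm] at this

theorem IsMinimalArc.isHullArc (hE : Module.finrank ℝ E = 2) {K : Set E} (hK : K.Finite)
    {x p q : E} {r : ℝ} (hr : 0 < r) (H : StrictConvexSpace ℝ E ∨ diam K ≤ r) {A : Set E}
    (h : IsMinimalArc x r p q A) (hx : K ⊆ closedBall x r) (hp : p ∈ K) (hq : q ∈ K) :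
    IsHullArc K r x p q A := by
  refine ⟨hx, hp, hq, h, fun z hz ↦ ?_⟩
  refine mem_frontier_of_mem_sphere hr (Set.iInter₂_subset x hx) ?_ (h.subset_sphere hz)
  exact Set.mem_iInter₂.2 fun y hy ↦ h.subset_closedBall hE hr
    (H.imp_right (dist_le_diam_of_mem hK.isBounded hp hq).trans) (hy hp) (hy hq) hz

/-- Functionals that agree at `p` and `q` are proportional, and only the sign of the factor affects
the arc. This finiteness yields maximal hull arcs. -/
theorem finite_setOf_isMinimalArc (hE : Module.finrank ℝ E = 2) (x p q : E) (r : ℝ) :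
    {A | IsMinimalArc x r p q A}.Finite := by
  by_cases hne : p = q
  · simp [IsMinimalArc, hne]
  obtain ⟨f, hf, hpq⟩ := exists_ne_zero_eq hE (p - q)
  rw [map_sub, sub_eq_zero] at hpq
  have hex : ∃ w, f w ≠ 0 := by
    by_contra! h
    exact hf (LinearMap.ext h)
  obtain ⟨w, hw⟩ := hex
  have hli : LinearIndependent ℝ ![p - q, w] := by
    rw [LinearIndependent.pair_iff' (sub_ne_zero.2 hne)]
    rintro c rfl
    simp [hpq] at hw
  refine ((Set.finite_singleton {y | y ∈ sphere x r ∧ (f p < f y ∨ y ∈ segment ℝ p q)}).insert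
    {y | y ∈ sphere x r ∧ (f y < f p ∨ y ∈ segment ℝ p q)}).subset ?_
  rintro A ⟨-, -, -, g, hg, hgpq, -, rfl⟩
  have hgf : g = (g w / f w) • f := by
    ext v
    obtain ⟨a, b, rfl⟩ := exists_eq_smul_add_smul hE hli v
    simp [hpq, hgpq]
    field_simp
  have hc : g w / f w ≠ 0 := fun h ↦ hg (by rw [hgf, h, zero_smul])
  rw [hgf]
  rcases hc.lt_or_gt with h | h
  · left; ext y
    simp [mul_lt_mul_left_of_neg h]
  · right; ext y
    simp [mul_lt_mul_iff_right₀ h]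

theorem IsHullArc.exists_isHullVertex (hE : Module.finrank ℝ E = 2) {K : Set E} (hK : K.Finite)
    {x p q : E} {r : ℝ} {A : Set E} (h : IsHullArc K r x p q A) :
    ∃ p' q' A', IsHullArc K r x p' q' A' ∧ A ⊆ A' ∧ IsHullVertex K r p' ∧ IsHullVertex K r q' := by
  have hfin : {A | ∃ p q, IsHullArc K r x p q A}.Finite := by
    refine (hK.biUnion fun p _ ↦ hK.biUnion fun q _ ↦
      finite_setOf_isMinimalArc hE x p q r).subset ?_
    rintro A ⟨p, q, h⟩
    exact Set.mem_biUnion h.2.1 (Set.mem_biUnion h.2.2.1 h.2.2.2.1)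
  obtain ⟨A', hle, ⟨p', q', h'⟩, hmax⟩ := hfin.exists_le_maximal ⟨p, q, h⟩
  have hmax' : ∀ a b B, IsHullArc K r x a b B → A' ⊆ B → B = A' :=
    fun a b B hB hs ↦ (hmax ⟨a, b, hB⟩ hs).antisymm hs
  exact ⟨p', q', A', h', hle, .inl ⟨x, q', A', h', hmax'⟩, .inl ⟨x, p', A', h'.symm, hmax'⟩⟩

/-! ### Endpoints of the arcs of the ball intersection. -/

/-- Spheres are locally connected. -/
theorem exists_isPreconnected_nhds_sphere {p x : E} {r : ℝ} (hr : 0 < r) (hx : x ∈ sphere p r)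
    {U : Set E} (hU : U ∈ 𝓝 x) :
    ∃ V, V ⊆ U ∩ sphere p r ∧ IsPreconnected V ∧ x ∈ V ∧
      ∀ᶠ u in 𝓝 x, u ∈ sphere p r → u ∈ V := by
  -- Radial projection onto the circle; `V` is the image of a small ball.
  set g : E → E := fun v ↦ p + (r / ‖v - p‖) • (v - p) with hg
  have hne : ∀ v ∈ sphere p r, ‖v - p‖ ≠ 0 := fun v hv ↦ by
    rw [mem_sphere_iff_norm.1 hv]; exact hr.ne'
  have hid : ∀ v ∈ sphere p r, g v = v := fun v hv ↦ by
    simp [hg, mem_sphere_iff_norm.1 hv, div_self hr.ne']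
  have hcont : ∀ v, ‖v - p‖ ≠ 0 → ContinuousAt g v := fun v hv ↦ by
    apply ContinuousAt.add continuousAt_const
    have h1 : ContinuousAt (fun v ↦ r / ‖v - p‖) v := continuousAt_const.div (by fun_prop) hv
    exact h1.smul (by fun_prop)
  have h1 : ∀ᶠ v in 𝓝 x, g v ∈ U ∧ ‖v - p‖ ≠ 0 := by
    refine ((hcont x (hne x hx)).eventually (by rwa [hid x hx])).and ?_
    exact (show ContinuousAt (fun v ↦ ‖v - p‖) x by fun_prop).eventually_ne (hne x hx)
  obtain ⟨ε, hε, hball⟩ := Metric.eventually_nhds_iff_ball.1 h1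
  refine ⟨g '' ball x ε, ?_, ?_, ⟨x, mem_ball_self hε, hid x hx⟩, ?_⟩
  · rintro _ ⟨v, hv, rfl⟩
    refine ⟨(hball v hv).1, ?_⟩
    have := (hball v hv).2
    rw [mem_sphere_iff_norm, hg]
    simp only [add_sub_cancel_left, norm_smul, norm_div, norm_norm, Real.norm_of_nonneg hr.le]
    field_simp
  · exact (convex_ball x ε).isPreconnected.image g
      fun v hv ↦ (hcont v (hball v hv).2).continuousWithinAt
  · filter_upwards [ball_mem_nhds x hε] with u hu hus
    exact ⟨u, hu, hid u hus⟩

theorem frontier_ballIntersection_subset {E : Type*} [NormedAddCommGroup E] (K : Set E) (r : ℝ) :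
    frontier (ballIntersection K r) ⊆ ballIntersection K r :=
  (isClosed_ballIntersection K r).frontier_subset

theorem mem_sphere_inter_frontier {K : Set E} {r : ℝ} (hr : 0 < r) {p y : E} (hp : p ∈ K) :
    y ∈ sphere p r ∩ frontier (ballIntersection K r) ↔
      y ∈ sphere p r ∧ y ∈ ballIntersection K r :=
  ⟨fun h ↦ ⟨h.1, frontier_ballIntersection_subset K r h.2⟩, fun h ↦
    ⟨h.1, mem_frontier_of_mem_sphere hr (Set.iInter₂_subset p hp) h.2 h.1⟩⟩

/-- The circle around an endpoint of an arc of the ball intersection contains at least two points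
of `K`. -/
theorem exists_ne_mem_sphere {K : Set E} (hK : K.Finite) {r : ℝ} (hr : 0 < r) {p x y : E}
    (hp : p ∈ K) {A : Set E}
    (hA : A = connectedComponentIn (sphere p r ∩ frontier (ballIntersection K r)) y)
    (hx : x ∈ A) (hxc : x ∈ closure (sphere p r \ A)) :
    ∃ k ∈ K, k ≠ p ∧ k ∈ sphere x r := by
  by_contra! hcon
  have hxF := connectedComponentIn_subset _ _ (hA ▸ hx)
  have hxI := ((mem_sphere_inter_frontier hr hp).1 hxF).2
  -- The constraints from the other points of `K` are strict at `x`, hence near `x`. A connected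
  -- piece of `S(p, r)` around `x` then lies in `A`.
  have hU : ∀ᶠ u in 𝓝 x, ∀ k ∈ K, k ≠ p → dist u k < r := by
    rw [eventually_all_finite hK]
    intro k hk
    by_cases hkp : k = p
    · simp [hkp]
    · have : dist x k < r := by
        refine lt_of_le_of_ne (Set.mem_iInter₂.1 hxI k hk) fun h ↦ hcon k hk hkp ?_
        rwa [mem_sphere, dist_comm]
      filter_upwards [(show ContinuousAt (fun u ↦ dist u k) x by fun_prop).eventually_lt_const this]
        with u hu _ using hu
  obtain ⟨V, hVU, hV, hxV, hev⟩ := exists_isPreconnected_nhds_sphere hr hxF.1 hU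
  have hVF : V ⊆ sphere p r ∩ frontier (ballIntersection K r) := fun v hv ↦ by
    refine (mem_sphere_inter_frontier hr hp).2 ⟨(hVU hv).2, Set.mem_iInter₂.2 fun k hk ↦ ?_⟩
    by_cases hkp : k = p
    · rw [hkp]; exact sphere_subset_closedBall (hVU hv).2
    · exact ((hVU hv).1 k hk hkp).le
  have hVA : V ⊆ A := by
    rw [hA, connectedComponentIn_eq (hA ▸ hx)]
    exact hV.subset_connectedComponentIn hxV hVF
  obtain ⟨u, hu, hu'⟩ := (mem_closure_iff_frequently.1 hxc).and_eventually hev |>.exists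
  exact hu.2 (hVA (hu' hu.1))

theorem isHullArc_of_mem_ballIntersection (hE : Module.finrank ℝ E = 2) {K : Set E}
    (hK : K.Finite) {x p q : E} {r : ℝ} (hr : 0 < r)
    (H : StrictConvexSpace ℝ E ∨ diam K ≤ r) (hx : x ∈ ballIntersection K r)
    (hp : p ∈ K) (hq : q ∈ K) (hne : p ≠ q) (hpx : p ∈ sphere x r) (hqx : q ∈ sphere x r) :
    ∃ A, IsHullArc K r x p q A := by
  obtain ⟨A, hA⟩ := exists_isMinimalArc hE hne hpx hqx
  exact ⟨A, hA.isHullArc hE hK hr H (mem_ballIntersection.1 hx) hp hq⟩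

/-- An arc of the ball intersection with an endpoint `x` is contained in the circle around `q₁` or
`q₂`, if its center is on a minimal arc between `q₁` and `q₂` of the circle around `x`. -/
theorem subset_sphere_or_subset_sphere (hE : Module.finrank ℝ E = 2) {K : Set E} (hK : K.Finite)
    {r : ℝ} (hr : 0 < r) (H : StrictConvexSpace ℝ E ∨ diam K ≤ r) {p x y q₁ q₂ : E} (hp : p ∈ K)
    {A B : Set E}
    (hA : A = connectedComponentIn (sphere p r ∩ frontier (ballIntersection K r)) y)
    (hx : x ∈ A) (hxc : x ∈ closure (sphere p r \ A)) (hB : IsHullArc K r x q₁ q₂ B)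
    (hpB : p ∈ B) : A ⊆ sphere q₁ r ∨ A ⊆ sphere q₂ r := by
  have hAF : ∀ v ∈ A, v ∈ sphere p r ∧ v ∈ ballIntersection K r := fun v hv ↦
    (mem_sphere_inter_frontier hr hp).1 (connectedComponentIn_subset _ _ (hA ▸ hv))
  obtain ⟨hxK, hq₁, hq₂, harc, -⟩ := hB
  have n₁ := mem_sphere_iff_norm.1 harc.2.1
  have n₂ := mem_sphere_iff_norm.1 harc.2.2.1
  have nz := mem_sphere_iff_norm.1 (harc.subset_sphere hpB)
  have hd : StrictConvexSpace ℝ E ∨ ‖(q₁ - x) - (q₂ - x)‖ ≤ r := by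
    rw [sub_sub_sub_cancel_right, ← dist_eq_norm]
    exact H.imp_right (dist_le_diam_of_mem hK.isBounded hq₁ hq₂).trans
  have hAK : ∀ v ∈ A, ∀ k ∈ K, ‖(k - x) - (v - x)‖ ≤ r := fun v hv k hk ↦ by
    rw [sub_sub_sub_cancel_right, ← dist_eq_norm]
    exact mem_ballIntersection.1 (hAF v hv).2 hk
  have hAp : ∀ v ∈ A, ‖(p - x) - (v - x)‖ = r := fun v hv ↦ by
    rw [sub_sub_sub_cancel_right, ← dist_eq_norm, dist_comm]
    exact (hAF v hv).1
  by_cases hop : q₁ - x = -(q₂ - x)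
  · left
    intro v hv
    have h1 := hAK v hv q₁ hq₁
    rw [hop] at h1 hd
    have := eq_zero_of_norm_sub_neg hr hd n₂ h1 (hAK v hv q₂ hq₂)
    rw [sub_eq_zero.1 this, mem_sphere, dist_comm]
    exact harc.2.1
  have hli := linearIndependent_of_norm_eq hr n₁ n₂ (by simpa using harc.1) hop
  by_contra! hcon
  obtain ⟨⟨y₁, hy₁, hn₁⟩, ⟨y₂, hy₂, hn₂⟩⟩ := hcon.imp Set.not_subset.1 Set.not_subset.1
  have hpq₁ : p ≠ q₁ := by rintro rfl; exact hn₁ (hAF _ hy₁).1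
  have hpq₂ : p ≠ q₂ := by rintro rfl; exact hn₂ (hAF _ hy₂).1
  obtain ⟨α, β, hα, hβ, hs, e⟩ := harc.exists_coords hE hr hli hpB
  have hα0 : α ≠ 0 := by
    rintro rfl
    rw [zero_smul, zero_add] at e
    rw [e, norm_smul, n₂, Real.norm_of_nonneg hβ] at nz
    rw [mul_right_cancel₀ hr.ne' (nz.trans (one_mul r).symm)] at e
    simp [hpq₂] at e
  have hβ0 : β ≠ 0 := by
    rintro rfl
    rw [zero_smul, add_zero] at e
    rw [e, norm_smul, n₁, Real.norm_of_nonneg hα] at nz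
    rw [mul_right_cancel₀ hr.ne' (nz.trans (one_mul r).symm)] at e
    simp [hpq₁] at e
  have lt_of_not : ∀ v ∈ A, ∀ k ∈ K, v ∉ sphere k r → ‖(k - x) - (v - x)‖ < r :=
    fun v hv k hk hn ↦ (hAK v hv k hk).lt_of_ne fun h ↦ hn <| by
      rwa [sub_sub_sub_cancel_right, ← dist_eq_norm, dist_comm] at h
  have nonzero : ∀ v ∈ A, ∀ k, ‖k - x‖ = r → v ∉ sphere k r → v - x ≠ 0 := fun v _ k hk hn h0 ↦ by
    rw [sub_eq_zero.1 h0, mem_sphere, dist_comm, dist_eq_norm] at hn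
    exact hn hk
  -- Since `v` is off `S(k, r)`, the ray from `p` must hit the segment `kl` at `l`. The parameters
  -- `0`, `1` and `1 + γ` then all give norm `r`, so `S(p, r)` contains the segment `xv`.
  have ray : ∀ v ∈ A, ∀ k ∈ K, ∀ l ∈ K, ‖k - x‖ = r → v ∉ sphere k r → p ≠ l →
      (∃ γ : ℝ, 0 ≤ γ ∧ (p - x) - γ • (v - x) ∈ segment ℝ (k - x) (l - x)) →
      ∃ γ : ℝ, 0 ≤ γ ∧ (p - x) - (l - x) = γ • (v - x) ∧
        ∀ s : ℝ, 0 ≤ s → s ≤ 1 → ‖(p - x) - s • (v - x)‖ = r := by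
    rintro v hv k hk l hl hkx hvk hpl ⟨γ, hγ, hm⟩
    obtain ⟨h1, h2⟩ := eq_of_sub_smul_mem_segment nz (hAp v hv) (lt_of_not v hv k hk hvk)
      (hAK v hv l hl) hγ hm
    refine ⟨γ, hγ, by rw [← h1]; module, fun s hs0 hs1 ↦ ?_⟩
    have hγ0 : 0 < γ := hγ.lt_of_ne' fun h0 ↦ hpl (by simpa [h0] using h1)
    refine norm_sub_smul_eq hγ0 nz (hAp v hv) ?_ hs0 hs1
    rw [← h2, ← h1]
    congr 1
    module
  obtain ⟨a₁, b₁, c₁⟩ := exists_eq_smul_add_smul hE hli (y₁ - x)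
  obtain ⟨a₂, b₂, c₂⟩ := exists_eq_smul_add_smul hE hli (y₂ - x)
  obtain ⟨γ₁, hγ₁, e₁, s₁⟩ := ray y₁ hy₁ q₁ hq₁ q₂ hq₂ n₁ hn₁ hpq₂
    (exists_sub_smul_mem_segment hr hd hli n₁ n₂ nz hα hβ hs e c₁ (nonzero y₁ hy₁ q₁ n₁ hn₁)
      (hAK y₁ hy₁ q₁ hq₁) (hAK y₁ hy₁ q₂ hq₂))
  obtain ⟨γ₂, hγ₂, e₂, s₂⟩ := ray y₂ hy₂ q₂ hq₂ q₁ hq₁ n₂ hn₂ hpq₁ (by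
    rw [segment_symm]
    exact exists_sub_smul_mem_segment hr hd hli n₁ n₂ nz hα hβ hs e c₂ (nonzero y₂ hy₂ q₂ n₂ hn₂)
      (hAK y₂ hy₂ q₁ hq₁) (hAK y₂ hy₂ q₂ hq₂))
  have hev := eventually_mem_segment hE hli hr (hα.lt_of_ne' hα0) (hβ.lt_of_ne' hβ0) hγ₁ hγ₂ e
    e₁ e₂ s₁ s₂
  have hev' : ∀ᶠ u in 𝓝 x, ‖(p - x) - (u - x)‖ = r →
      u - x ∈ segment ℝ 0 (y₁ - x) ∪ segment ℝ 0 (y₂ - x) :=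
    (show Tendsto (fun u ↦ u - x) (𝓝 x) (𝓝 0) from
      Continuous.tendsto' (by fun_prop) _ _ (sub_self x)).eventually hev
  -- The segment is connected and lies both in the circle and in the convex set `bi`, so it stays in
  -- the component `A`.
  have seg : ∀ v ∈ A, (∀ s : ℝ, 0 ≤ s → s ≤ 1 → ‖(p - x) - s • (v - x)‖ = r) →
      segment ℝ x v ⊆ A := fun v hv hs ↦ by
    rw [hA, connectedComponentIn_eq (hA ▸ hx)]
    refine (convex_segment x v).isPreconnected.subset_connectedComponentIn
      (left_mem_segment ℝ x v) fun w hw ↦ (mem_sphere_inter_frontier hr hp).2 ⟨?_, ?_⟩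
    · obtain ⟨a, b, ha, hb, hab, rfl⟩ := hw
      rw [mem_sphere, dist_comm, dist_eq_norm, ← hs b hb (by linarith)]
      obtain rfl : a = 1 - b := by linarith
      congr 1
      module
    · exact (convex_ballIntersection K r).segment_subset (hAF x hx).2 (hAF v hv).2 hw
  have trans_seg : ∀ u v : E, u - x ∈ segment ℝ 0 (v - x) → u ∈ segment ℝ x v := by
    rintro u v ⟨a, b, ha, hb, hab, h⟩
    refine ⟨a, b, ha, hb, hab, ?_⟩
    obtain rfl : a = 1 - b := by linarith
    rw [← sub_left_inj (a := x), ← h]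
    module
  -- A point of the circle outside `A`, close enough to `x` to lie on one of the two segments.
  obtain ⟨u, hu, hu'⟩ := (mem_closure_iff_frequently.1 hxc).and_eventually hev' |>.exists
  refine hu.2 ?_
  rcases hu' (by rw [sub_sub_sub_cancel_right, ← dist_eq_norm, dist_comm]; exact hu.1) with h | h
  · exact seg y₁ hy₁ s₁ (trans_seg _ _ h)
  · exact seg y₂ hy₂ s₂ (trans_seg _ _ h)

/-! ### Full circles, existence of endpoints, and the theorem. -/

theorem eq_of_sphere_subset_closedBall {p k : E} {r : ℝ} (hr : 0 < r)
    (h : sphere p r ⊆ closedBall k r) : k = p := by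
  by_contra hne
  rw [← sub_eq_zero, ← norm_eq_zero] at hne
  have hpos : 0 < ‖k - p‖ := (norm_nonneg _).lt_of_ne' hne
  have h1 := h (show p - (r / ‖k - p‖) • (k - p) ∈ sphere p r by
    simp [norm_smul, abs_of_pos hr, hne])
  rw [mem_closedBall, dist_comm, dist_eq_norm, show k - (p - (r / ‖k - p‖) • (k - p)) =
    (1 + r / ‖k - p‖) • (k - p) by module, norm_smul, Real.norm_of_nonneg (by positivity),
    add_mul, div_mul_cancel₀ _ hne] at h1
  linarith

/-- `A` and the closure of its complement in the circle are closed, nonempty and cover the connected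
circle, so they meet. -/
theorem exists_endpoint_of_ne_sphere (hE : Module.finrank ℝ E = 2) {p y : E} {r : ℝ}
    {F A : Set E} (hF : IsClosed F) (hA : A = connectedComponentIn (sphere p r ∩ F) y)
    (hy : y ∈ A) (hne : A ≠ sphere p r) : ∃ x ∈ A, x ∈ closure (sphere p r \ A) := by
  have hAS : A ⊆ sphere p r := hA ▸ (connectedComponentIn_subset _ _).trans Set.inter_subset_left
  have hrank : 1 < Module.rank ℝ E := by
    have : FiniteDimensional ℝ E := .of_finrank_pos (by omega)
    rw [← Module.finrank_eq_rank, hE]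
    exact_mod_cast one_lt_two
  have hclosed : IsClosed A := by
    rw [← closure_subset_iff_isClosed]
    have hpc : IsPreconnected A := hA ▸ isPreconnected_connectedComponentIn
    have hsub : A ⊆ sphere p r ∩ F := hA ▸ connectedComponentIn_subset _ _
    have := hpc.closure.subset_connectedComponentIn (subset_closure hy)
      ((isClosed_sphere.inter hF).closure_subset_iff.2 hsub)
    rwa [← hA] at this
  obtain ⟨w, hw⟩ := Set.nonempty_of_ssubset (hAS.ssubset_of_ne hne)
  obtain ⟨x, -, hxA, hxc⟩ := isPreconnected_closed_iff.1 (isPreconnected_sphere hrank p r) A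
    (closure (sphere p r \ A)) hclosed isClosed_closure
    (fun v hv ↦ (em (v ∈ A)).imp id fun h ↦ subset_closure ⟨hv, h⟩) ⟨y, hAS hy, hy⟩
    ⟨w, hw.1, subset_closure hw⟩
  exact ⟨x, hxA, hxc⟩

end NormedPlane

theorem theorem3p11 {E : Type*} [NormedAddCommGroup E] [NormedSpace ℝ E]
    (hE : Module.finrank ℝ E = 2)
    (K : Set E) (hKfin : K.Finite) (hKne : K.Nonempty)
    (r : ℝ) (hr : 0 < r) (hcirc : NormedPlane.circumradius K ≤ r)
    (h : StrictConvexSpace ℝ E ∨ Metric.diam K ≤ r) :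
    (∀ (p : E) (A : Set E), NormedPlane.IsIntersectionArc K r p A →
      ∃ v : E, NormedPlane.IsHullVertex K r v ∧ A ⊆ Metric.sphere v r) ∧
    (∀ x : E, NormedPlane.IsIntersectionVertex K r x →
      ∃ (p q : E) (A : Set E), NormedPlane.IsHullArc K r x p q A) := by
  have hullArc : ∀ (p y x : E) (A : Set E), p ∈ K →
      A = connectedComponentIn (Metric.sphere p r ∩ frontier (NormedPlane.ballIntersection K r)) y →
      x ∈ A → x ∈ closure (Metric.sphere p r \ A) →
      ∃ q B, NormedPlane.IsHullArc K r x p q B := by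
    intro p y x A hp hA hx hxc
    obtain ⟨k, hk, hkp, hkx⟩ := NormedPlane.exists_ne_mem_sphere hKfin hr hp hA hx hxc
    have hxF := (NormedPlane.mem_sphere_inter_frontier hr hp).1
      (connectedComponentIn_subset _ _ (hA ▸ hx))
    exact ⟨k, NormedPlane.isHullArc_of_mem_ballIntersection hE hKfin hr h hxF.2 hp hk hkp.symm
      (Metric.mem_sphere_comm.1 hxF.1) hkx⟩
  refine ⟨?_, ?_⟩
  · rintro p A ⟨hp, ⟨y, hy, hA⟩, -⟩
    have hyA : y ∈ A := hA ▸ mem_connectedComponentIn hy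
    -- A full circle has no endpoint to start from; here `p` is a vertex through the one-point
    -- clause of `IsHullVertex`.
    by_cases hne : A = Metric.sphere p r
    · have hKp : K = {p} := by
        refine Set.eq_singleton_iff_unique_mem.2 ⟨hp, fun k hk ↦ ?_⟩
        refine NormedPlane.eq_of_sphere_subset_closedBall hr fun v hv ↦ ?_
        have hvF := connectedComponentIn_subset _ _ (hA ▸ hne ▸ hv)
        exact Set.mem_iInter₂.1 (NormedPlane.frontier_ballIntersection_subset K r hvF.2) k hk
      have : Nontrivial E := Module.nontrivial_of_finrank_pos (R := ℝ) (by omega)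
      exact ⟨p, .inr (by rw [hKp]; exact NormedPlane.ballHull_singleton hr p), hne.subset⟩
    · obtain ⟨x, hx, hxc⟩ :=
        NormedPlane.exists_endpoint_of_ne_sphere hE isClosed_frontier hA hyA hne
      obtain ⟨q, B, hB⟩ := hullArc p y x A hp hA hx hxc
      obtain ⟨q₁, q₂, B', hB', hsub, hv₁, hv₂⟩ := hB.exists_isHullVertex hE hKfin
      rcases NormedPlane.subset_sphere_or_subset_sphere hE hKfin hr h hp hA hx hxc hB'
        (hsub hB.2.2.2.1.left_mem) with hs | hs
      · exact ⟨q₁, hv₁, hs⟩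
      · exact ⟨q₂, hv₂, hs⟩
  · rintro x ⟨p, A, ⟨hp, ⟨y, hy, hA⟩, -⟩, hx, hxc⟩
    obtain ⟨q, B, hB⟩ := hullArc p y x A hp hA hx hxc
    exact ⟨p, q, B, hB⟩
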